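/- Let $K$ be a number field of degree $d=[K:\mathbb{Q}]$. For $x=(x_0:x_1)\in\mathbb{P}^1(K)$ let $$H(x)=\Bigl(\prod_{v}\max(|x_0|_v,|x_1|_v)\Bigr)^{1/d}$$ be the absolute height, the product being over all places $v$ of $K$ with the normalised absolute values (the usual one for real $v$, the square of the usual one for complex $v$, and $|\pi|_v=1/q_v$ for a uniformiser $\pi$ at a finite place with residue field of $q_v$ elements). For every real $N$ the set $\{x\in\mathbb{P}^1(K): H(x)\le N\}$ is finite. A subset $A\subseteq\mathbb{P}^1(K)$ is said to have height density $\delta$ if $$\liminf_{N\to\infty}\frac{\#\{x\in A: H(x)\le N\}}{\#\{x\in\mathbb{P}^1(K): H(x)\le N\}}=\limsup_{N\to\infty}\frac{\#\{x\in A: H(x)\le N\}}{\#\{x\in\mathbb{P}^1(K): H(x)\le N\}}=\delta .$$ Let $f_1,\dots,f_n\in K(t)$ be rational functions, regarded as maps $\mathbb{P}^1(K)\to\mathbb{P}^1(K)$, each of degree at least $2$ (the degree of $p/q$ in lowest terms being $\max(\deg p,\deg q)$), and let $x_0\in\mathbb{P}^1(K)$. Assume that the family $(f_1,\dots,f_n)$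 is injective at $x_0$, that is, the map from the free monoid on $n$ letters to $\mathbb{P}^1(K)$ which sends a word $i_1i_2\cdots i_r$ to $(f_{i_1}\circ f_{i_2}\circ\cdots\circ f_{i_r})(x_0)$ (and the empty word to $x_0$) is injective. Let $\Gamma$ be the monoid generated by $f_1,\dots,f_n$ under composition, and let $\Gamma(x_0)=\{\gamma(x_0):\gamma\in\Gamma\}$. Then $\Gamma(x_0)$ has height density $0$. Moreover, there is a positive integer $k$ such that, as $N\to\infty$, $$\#\{x\in\Gamma(x_0): H(x)\le N\}=O\bigl((\log N)^k\bigr).$$ -/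

import Mathlib

open Polynomial Filter Topology Asymptotics
open scoped LinearAlgebra.Projectivization

noncomputable section

namespace RationalOrbit

variable {K : Type*} [Field K]

/-- The degree of the rational map `f = p / q` (in lowest terms): `max (deg p) (deg q)`. -/
def degree (f : RatFunc K) : ℕ := max f.num.natDegree f.denom.natDegree

/-- The homogeneous lift of `f = p / q` (in lowest terms, of degree `d`) to `K²`:
`(x, y) ↦ (y ^ d * p (x / y), y ^ d * q (x / y))`, both entries being read as homogeneous
polynomials of degree `d` in `x` and `y`. -/
def homLift (f : RatFunc K) (v : Fin 2 → K) : Fin 2 → K :=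
  ![MvPolynomial.eval v (f.num.homogenize (degree f)),
    MvPolynomial.eval v (f.denom.homogenize (degree f))]

theorem eval_homogenize_eq_sum (p : K[X]) (n : ℕ) (v : Fin 2 → K) :
    MvPolynomial.eval v (p.homogenize n) =
      ∑ kl ∈ Finset.HasAntidiagonal.antidiagonal n, p.coeff kl.1 * (v 0 ^ kl.1 * v 1 ^ kl.2) := by
  rw [Polynomial.homogenize, MvPolynomial.eval_sum]
  refine Finset.sum_congr rfl fun kl _ => ?_
  rw [MvPolynomial.eval_monomial, Finsupp.prod_fintype _ _ (by simp), Fin.prod_univ_two]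
  simp

theorem eval_homogenize_smul (p : K[X]) (n : ℕ) (t : K) (v : Fin 2 → K) :
    MvPolynomial.eval (t • v) (p.homogenize n) = t ^ n * MvPolynomial.eval v (p.homogenize n) := by
  rw [eval_homogenize_eq_sum, eval_homogenize_eq_sum, Finset.mul_sum]
  refine Finset.sum_congr rfl fun kl hkl => ?_
  rw [← Finset.HasAntidiagonal.mem_antidiagonal.1 hkl]
  simp only [Pi.smul_apply, smul_eq_mul]
  ring

theorem homLift_smul (f : RatFunc K) (t : K) (v : Fin 2 → K) :
    homLift f (t • v) = t ^ degree f • homLift f v := by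
  ext i
  fin_cases i <;> simp [homLift, eval_homogenize_smul]

theorem eval_homogenize_one_zero (p : K[X]) (n : ℕ) :
    MvPolynomial.eval ![1, 0] (p.homogenize n) = p.coeff n := by
  rw [eval_homogenize_eq_sum, Finset.sum_eq_single (n, 0)]
  · simp
  · rintro ⟨k, l⟩ hkl hne
    have hl : l ≠ 0 := by
      rintro rfl
      exact hne (by simpa using hkl)
    simp [hl]
  · simp

theorem homLift_ne_zero (f : RatFunc K) {v : Fin 2 → K} (hv : v ≠ 0) : homLift f v ≠ 0 := by
  intro h
  have h0 : MvPolynomial.eval v (f.num.homogenize (degree f)) = 0 := congrFun h 0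
  have h1 : MvPolynomial.eval v (f.denom.homogenize (degree f)) = 0 := congrFun h 1
  by_cases hy : v 1 = 0
  · have hx : v 0 ≠ 0 := fun hx => hv (by ext i; fin_cases i <;> simp [hx, hy])
    have hv' : v = v 0 • ![1, 0] := by ext i; fin_cases i <;> simp [hy]
    rw [hv', eval_homogenize_smul, eval_homogenize_one_zero] at h0 h1
    have hc0 := (mul_eq_zero.1 h0).resolve_left (pow_ne_zero _ hx)
    have hc1 := (mul_eq_zero.1 h1).resolve_left (pow_ne_zero _ hx)
    rcases le_or_gt f.num.natDegree f.denom.natDegree with hle | hlt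
    · rw [degree, max_eq_right hle, coeff_natDegree, leadingCoeff_eq_zero] at hc1
      exact f.denom_ne_zero hc1
    · rw [degree, max_eq_left hlt.le, coeff_natDegree, leadingCoeff_eq_zero] at hc0
      simp [hc0] at hlt
  · rw [eval_homogenize (n := degree f) (le_max_left _ _) v hy] at h0
    rw [eval_homogenize (n := degree f) (le_max_right _ _) v hy] at h1
    have h0' := (mul_eq_zero.1 h0).resolve_right (pow_ne_zero _ hy)
    have h1' := (mul_eq_zero.1 h1).resolve_right (pow_ne_zero _ hy)
    obtain ⟨a, b, hab⟩ := f.isCoprime_num_denom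
    have := congrArg (Polynomial.eval (v 0 / v 1)) hab
    simp [h0', h1'] at this

/-- The self-map of `ℙ¹(K)` given by the rational function `f`. -/
def toMap (f : RatFunc K) : Function.End (ℙ K (Fin 2 → K)) :=
  Projectivization.lift
    (fun v => Projectivization.mk K (homLift f v.1) (homLift_ne_zero f v.2)) (by
      intro a b t h
      rw [Projectivization.mk_eq_mk_iff']
      exact ⟨t ^ degree f, by rw [h, homLift_smul]⟩)

/-- The evaluation map `Ω` from the free monoid on `n` letters to `ℙ¹(K)`: the word
`i₁ i₂ ⋯ iᵣ` goes to `(f_{i₁} ∘ f_{i₂} ∘ ⋯ ∘ f_{iᵣ}) x₀`. -/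
def evaluation {n : ℕ} (f : Fin n → RatFunc K) (x₀ : ℙ K (Fin 2 → K))
    (w : FreeMonoid (Fin n)) : ℙ K (Fin 2 → K) :=
  FreeMonoid.lift (fun i => toMap (f i)) w x₀

/-- The family `f` is injective at `x₀`. -/
def IsInjectiveAt {n : ℕ} (f : Fin n → RatFunc K) (x₀ : ℙ K (Fin 2 → K)) : Prop :=
  Function.Injective (evaluation f x₀)

/-- The monoid (under composition) of self-maps of `ℙ¹(K)` generated by the family `f`. -/
def generatedMonoid {n : ℕ} (f : Fin n → RatFunc K) : Submonoid (Function.End (ℙ K (Fin 2 → K))) :=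
  Submonoid.closure (Set.range fun i => toMap (f i))

/-- The orbit `Γ(x₀)` of `x₀` under the monoid `Γ` generated by the family `f`. -/
def orbit {n : ℕ} (f : Fin n → RatFunc K) (x₀ : ℙ K (Fin 2 → K)) : Set (ℙ K (Fin 2 → K)) :=
  {x | ∃ γ ∈ generatedMonoid f, γ x₀ = x}

variable [NumberField K]

/-- The absolute (multiplicative) height on `ℙ¹(K)`: the `[K : ℚ]`-th root of the height
relative to `K`. -/
def absHeight (x : ℙ K (Fin 2 → K)) : ℝ :=
  x.mulHeight ^ ((Module.finrank ℚ K : ℝ)⁻¹)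

/-- The points of `A` of absolute height at most `N`. -/
def heightBall (A : Set (ℙ K (Fin 2 → K))) (N : ℝ) : Set (ℙ K (Fin 2 → K)) :=
  {x | x ∈ A ∧ absHeight x ≤ N}

/-- The proportion of the points of `ℙ¹(K)` of height at most `N` that lie in `A`. -/
def heightProportion (A : Set (ℙ K (Fin 2 → K))) (N : ℝ) : ℝ :=
  ((heightBall A N).ncard : ℝ) /
    ((heightBall (Set.univ : Set (ℙ K (Fin 2 → K))) N).ncard : ℝ)

/-- The lower height density. -/
def lowerHeightDensity (A : Set (ℙ K (Fin 2 → K))) : ℝ :=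
  liminf (heightProportion A) atTop

/-- The upper height density. -/
def upperHeightDensity (A : Set (ℙ K (Fin 2 → K))) : ℝ :=
  limsup (heightProportion A) atTop

/-- `A` has height density `δ`. -/
def HasHeightDensity (A : Set (ℙ K (Fin 2 → K))) (δ : ℝ) : Prop :=
  lowerHeightDensity A = δ ∧ upperHeightDensity A = δ

end RationalOrbit

end

/-!
A rational map of degree at least `2` roughly doubles the logarithmic height, or more: this is the
Nullstellensatz for two coprime binary forms. Let `h` be the logarithmic height and `1 < b < 2`.
For large `B`, every point of the orbit of height at most `b * B` is `x₀` or the image under some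
`fᵢ` of a point of the orbit of height at most `B`, since otherwise that preimage would be sent too
far. Hence the number `c B` of points of the orbit with `h ≤ B` satisfies
`c (b * B) ≤ (n + 1) * c B`, so it grows at most polynomially in `B`, that is, in `log N` where
`N` bounds the absolute height. On the other hand the integers alone give at least `N` points of
absolute height at most `N`.
-/

namespace RationalOrbit

section Bezout

variable {K : Type*} [Field K]

theorem exists_natDegree_le_mul_add_mul_eq_of_natDegree_le {p q r : K[X]} {M : ℕ}
    (hpq : IsCoprime p q) (hqp : q.natDegree ≤ p.natDegree) (hM : p.natDegree ≤ M)
    (hr : r.natDegree ≤ M + p.natDegree) :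
    ∃ u v : K[X], u.natDegree ≤ M ∧ v.natDegree ≤ M ∧ u * p + v * q = r := by
  obtain ⟨a, b, hab⟩ := hpq
  rcases eq_or_ne p 0 with rfl | hp
  · have hb : b.natDegree = 0 :=
      natDegree_eq_zero_of_isUnit (.of_mul_eq_one q (by simpa using hab))
    refine ⟨0, b * r, by simp, ?_, by linear_combination r * hab⟩
    simpa [hb] using (natDegree_mul_le (p := b) (q := r)).trans (Nat.add_le_add_left hr _)
  set u := a * r + b * r / p * q
  set v := b * r % p
  have huv : u * p + v * q = r := by
    linear_combination r * hab + q * EuclideanDomain.div_add_mod (b * r) p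
  have hv : v.natDegree ≤ p.natDegree := natDegree_le_natDegree (degree_mod_lt _ hp).le
  refine ⟨u, v, ?_, hv.trans hM, huv⟩
  rcases eq_or_ne u 0 with hu | hu
  · simp [hu]
  have hup : (u * p).natDegree ≤ M + p.natDegree := by
    rw [eq_sub_of_add_eq huv]
    simpa using natDegree_sub_le_of_le hr (natDegree_mul_le_of_le (hv.trans hM) hqp)
  rw [natDegree_mul hu hp] at hup
  exact Nat.le_of_add_le_add_right hup

theorem exists_natDegree_le_mul_add_mul_eq {p q r : K[X]} {M : ℕ} (hpq : IsCoprime p q)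
    (hM : max p.natDegree q.natDegree ≤ M)
    (hr : r.natDegree ≤ M + max p.natDegree q.natDegree) :
    ∃ u v : K[X], u.natDegree ≤ M ∧ v.natDegree ≤ M ∧ u * p + v * q = r := by
  rcases le_total q.natDegree p.natDegree with h | h
  · rw [max_eq_left h] at hM hr
    exact exists_natDegree_le_mul_add_mul_eq_of_natDegree_le hpq h hM hr
  · rw [max_eq_right h] at hM hr
    obtain ⟨u, v, hu, hv, huv⟩ :=
      exists_natDegree_le_mul_add_mul_eq_of_natDegree_le hpq.symm h hM hr
    exact ⟨v, u, hv, hu, by rw [add_comm, huv]⟩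

theorem exists_homogenize_mul_add_mul_eq {p q r : K[X]} {d : ℕ} (hpq : IsCoprime p q)
    (hd : max p.natDegree q.natDegree = d) (hr : r.natDegree ≤ d + d) :
    ∃ u v : K[X], u.homogenize d * p.homogenize d + v.homogenize d * q.homogenize d =
      r.homogenize (d + d) := by
  obtain ⟨u, v, hu, hv, rfl⟩ := exists_natDegree_le_mul_add_mul_eq hpq hd.le (by rwa [hd])
  have hp : p.natDegree ≤ d := hd ▸ le_max_left _ _
  have hq : q.natDegree ≤ d := hd ▸ le_max_right _ _
  exact ⟨u, v, by rw [homogenize_add, homogenize_mul _ _ hu hp, homogenize_mul _ _ hv hq]⟩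

end Bezout

section HeightGrowth

variable {K : Type*} [Field K] [Height.AdmissibleAbsValues K]

theorem exists_degree_mul_logHeight_sub_le_logHeight_homLift (f : RatFunc K) :
    ∃ C : ℝ, ∀ v : Fin 2 → K,
      degree f * Height.logHeight v - C ≤ Height.logHeight (homLift f v) := by
  set d := degree f with hd
  let r : Fin 2 → K[X] := ![X ^ (d + d), 1]
  have hr (k : Fin 2) : (r k).natDegree ≤ d + d := by fin_cases k <;> simp [r]
  have hr_eval (k : Fin 2) (v : Fin 2 → K) :
      ((r k).homogenize (d + d)).eval v = v k ^ (d + d) := by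
    fin_cases k <;> simp [r]
  choose a b hab using fun k =>
    exists_homogenize_mul_add_mul_eq f.isCoprime_num_denom hd.symm (hr k)
  obtain ⟨C, hC⟩ := Height.logHeight_eval_ge' (N := d)
    (q := fun kj : Fin 2 × Fin 2 => (![a kj.1, b kj.1] kj.2).homogenize d)
    fun _ => isHomogeneous_homogenize _
  refine ⟨-C, fun v => ?_⟩
  have hbound := hC ![f.num.homogenize d, f.denom.homogenize d] (x := v) fun k => by
    simpa [hr_eval] using congrArg (MvPolynomial.eval v) (hab k)
  have hlift : (fun j => MvPolynomial.eval v (![f.num.homogenize d, f.denom.homogenize d] j)) =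
      homLift f v := by
    ext j
    fin_cases j <;> rfl
  rw [hlift] at hbound
  linarith

theorem exists_degree_mul_logHeight_sub_le_logHeight_toMap (f : RatFunc K) :
    ∃ C : ℝ, ∀ x : ℙ K (Fin 2 → K), degree f * x.logHeight - C ≤ (toMap f x).logHeight := by
  obtain ⟨C, hC⟩ := exists_degree_mul_logHeight_sub_le_logHeight_homLift f
  refine ⟨C, fun x => ?_⟩
  induction x using Projectivization.ind with
  | h v _ => exact hC v

theorem exists_two_mul_logHeight_sub_le_logHeight_toMap {ι : Type*} [Finite ι]
    {f : ι → RatFunc K} (hdeg : ∀ i, 2 ≤ degree (f i)) :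
    ∃ C : ℝ, ∀ i (x : ℙ K (Fin 2 → K)), 2 * x.logHeight - C ≤ (toMap (f i) x).logHeight := by
  choose C hC using fun i => exists_degree_mul_logHeight_sub_le_logHeight_toMap (f i)
  obtain ⟨D, hD⟩ := (Set.finite_range C).bddAbove
  refine ⟨D, fun i x => ?_⟩
  have hdeg_mul : (2 : ℝ) * x.logHeight ≤ degree (f i) * x.logHeight :=
    mul_le_mul_of_nonneg_right (by exact_mod_cast hdeg i) x.logHeight_nonneg
  linarith [hC i x, hD (Set.mem_range_self i)]

end HeightGrowth

section Counting

variable {X ι : Type*}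

/-- The counting function of `A` with respect to a height `h`. It is meant for sets with finitely
many points of bounded height: `Set.ncard` takes the junk value `0` on infinite sets. -/
noncomputable def heightCount (h : X → ℝ) (A : Set X) (B : ℝ) : ℕ := {x ∈ A | h x ≤ B}.ncard

theorem finite_setOf_mem_and_le (h : X → ℝ) [Northcott h] (A : Set X) (B : ℝ) :
    {x ∈ A | h x ≤ B}.Finite :=
  (Northcott.finite_le (h := h) B).subset fun _ hx => hx.2

theorem heightCount_mono (h : X → ℝ) [Northcott h] (A : Set X) : Monotone (heightCount h A) :=
  fun _ B hB => Set.ncard_le_ncard (fun _ hx => ⟨hx.1, hx.2.trans hB⟩)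
    (finite_setOf_mem_and_le h A B)

theorem setOf_le_mul_subset {h : X → ℝ} {g : ι → X → X} {A F : Set X} {a b B C : ℝ} (ha : 0 < a)
    (hg : ∀ i x, a * h x - C ≤ h (g i x)) (hA : A ⊆ F ∪ ⋃ i, g i '' A) (hF : ∀ x ∈ F, h x ≤ B)
    (hB : C ≤ (a - b) * B) :
    {x ∈ A | h x ≤ b * B} ⊆ {x ∈ A | h x ≤ B} ∪ ⋃ i, g i '' {x ∈ A | h x ≤ B} := by
  rintro x ⟨hxA, hx⟩
  rcases hA hxA with hxF | hx_image
  · exact .inl ⟨hxA, hF x hxF⟩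
  · obtain ⟨i, y, hyA, rfl⟩ := Set.mem_iUnion.1 hx_image
    have hy : a * h y ≤ a * B := by linarith [hg i y]
    exact .inr (Set.mem_iUnion.2 ⟨i, y, ⟨hyA, le_of_mul_le_mul_left hy ha⟩, rfl⟩)

theorem heightCount_mul_le [Fintype ι] {h : X → ℝ} [Northcott h] {g : ι → X → X} {A F : Set X}
    {a b B C : ℝ} (ha : 0 < a) (hg : ∀ i x, a * h x - C ≤ h (g i x))
    (hA : A ⊆ F ∪ ⋃ i, g i '' A) (hF : ∀ x ∈ F, h x ≤ B) (hB : C ≤ (a - b) * B) :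
    heightCount h A (b * B) ≤ (Fintype.card ι + 1) * heightCount h A B := by
  set S := {x ∈ A | h x ≤ B}
  have hS : S.Finite := finite_setOf_mem_and_le h A B
  calc heightCount h A (b * B) ≤ (S ∪ ⋃ i, g i '' S).ncard :=
        Set.ncard_le_ncard (setOf_le_mul_subset ha hg hA hF hB)
          (hS.union (Set.finite_iUnion fun i => hS.image (g i)))
    _ ≤ S.ncard + ∑ i, (g i '' S).ncard :=
        (Set.ncard_union_le _ _).trans
          (Nat.add_le_add_left (Set.ncard_iUnion_le_of_fintype _) _)
    _ ≤ S.ncard + ∑ _i : ι, S.ncard :=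
        Nat.add_le_add_left (Finset.sum_le_sum fun i _ => Set.ncard_image_le hS) _
    _ = (Fintype.card ι + 1) * heightCount h A B := by
        rw [Finset.sum_const, Finset.card_univ, smul_eq_mul, heightCount]
        ring

theorem apply_pow_mul_le_pow_mul {N : ℝ → ℝ} {b c B₀ : ℝ} (hb : 1 ≤ b) (hc : 0 ≤ c) (hB₀ : 0 ≤ B₀)
    (hN : ∀ B ≥ B₀, N (b * B) ≤ c * N B) (r : ℕ) : N (b ^ r * B₀) ≤ c ^ r * N B₀ := by
  induction r with
  | zero => simp
  | succ r ih =>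
    calc N (b ^ (r + 1) * B₀) = N (b * (b ^ r * B₀)) := by ring_nf
      _ ≤ c * N (b ^ r * B₀) := hN _ (le_mul_of_one_le_left hB₀ (one_le_pow₀ hb))
      _ ≤ c * (c ^ r * N B₀) := by gcongr
      _ = c ^ (r + 1) * N B₀ := by ring

theorem exists_isBigO_pow_of_apply_mul_le {N : ℝ → ℝ} {b c : ℝ} (hmono : Monotone N)
    (hnonneg : ∀ B, 0 ≤ N B) (hb : 1 < b) (hN : ∀ᶠ B in atTop, N (b * B) ≤ c * N B) :
    ∃ k : ℕ, 0 < k ∧ N =O[atTop] fun B => B ^ k := by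
  obtain ⟨B₀, hB₀⟩ := eventually_atTop.1 (hN.and (eventually_ge_atTop 1))
  have hB₀_one : 1 ≤ B₀ := (hB₀ B₀ le_rfl).2
  have hB₀_pos : 0 < B₀ := zero_lt_one.trans_le hB₀_one
  have hb_pos : 0 < b := zero_lt_one.trans hb
  obtain ⟨k, hk⟩ := pow_unbounded_of_one_lt c hb
  have hcK : c ≤ b ^ (k + 1) := hk.le.trans (pow_le_pow_right₀ hb.le k.le_succ)
  have hstep (B : ℝ) (hB : B ≥ B₀) : N (b * B) ≤ b ^ (k + 1) * N B :=
    (hB₀ B hB).1.trans (mul_le_mul_of_nonneg_right hcK (hnonneg B))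
  refine ⟨k + 1, k.succ_pos, IsBigO.of_bound (b ^ (k + 1) * N B₀) ?_⟩
  filter_upwards [eventually_ge_atTop B₀] with B hB
  obtain ⟨r, hr, hr'⟩ := exists_nat_pow_near ((one_le_div hB₀_pos).2 hB) hb
  rw [Real.norm_of_nonneg (hnonneg B),
    Real.norm_of_nonneg (pow_nonneg (hB₀_pos.le.trans hB) _)]
  have hNB₀ := hnonneg B₀
  calc N B ≤ N (b ^ (r + 1) * B₀) := hmono ((div_le_iff₀ hB₀_pos).1 hr'.le)
    _ ≤ (b ^ (k + 1)) ^ (r + 1) * N B₀ :=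
        apply_pow_mul_le_pow_mul hb.le (pow_pos hb_pos _).le hB₀_pos.le hstep _
    _ = b ^ (k + 1) * N B₀ * (b ^ r) ^ (k + 1) := by ring
    _ ≤ b ^ (k + 1) * N B₀ * B ^ (k + 1) := by
        gcongr
        exact hr.trans (div_le_self (hB₀_pos.le.trans hB) hB₀_one)

theorem exists_isBigO_pow_heightCount [Finite ι] {h : X → ℝ} [Northcott h] {g : ι → X → X}
    {A F : Set X} {a C : ℝ} (ha : 1 < a) (hg : ∀ i x, a * h x - C ≤ h (g i x))
    (hA : A ⊆ F ∪ ⋃ i, g i '' A) (hF : BddAbove (h '' F)) :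
    ∃ k : ℕ, 0 < k ∧ (fun B => (heightCount h A B : ℝ)) =O[atTop] fun B => B ^ k := by
  have := Fintype.ofFinite ι
  obtain ⟨b, hb, hba⟩ := exists_between ha
  obtain ⟨D, hD⟩ := hF
  refine exists_isBigO_pow_of_apply_mul_le (c := Fintype.card ι + 1)
    (Nat.mono_cast.comp (heightCount_mono h A)) (fun _ => Nat.cast_nonneg _) hb ?_
  filter_upwards [eventually_ge_atTop D,
    (tendsto_id.const_mul_atTop (sub_pos.2 hba)).eventually_ge_atTop C] with B hDB hCB
  exact_mod_cast heightCount_mul_le (zero_lt_one.trans ha) hg hA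
    (fun x hx => (hD (Set.mem_image_of_mem h hx)).trans hDB) hCB

end Counting

theorem orbit_subset {K : Type*} [Field K] {n : ℕ} (f : Fin n → RatFunc K)
    (x₀ : ℙ K (Fin 2 → K)) : orbit f x₀ ⊆ {x₀} ∪ ⋃ i, toMap (f i) '' orbit f x₀ := by
  rintro _ ⟨γ, hγ, rfl⟩
  induction hγ using Submonoid.closure_induction_left with
  | one => exact .inl rfl
  | mul_left g hg γ hγ _ =>
    obtain ⟨i, rfl⟩ := hg
    exact .inr (Set.mem_iUnion.2 ⟨i, γ x₀, ⟨γ, hγ, rfl⟩, rfl⟩)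

theorem exists_isBigO_pow_heightCount_orbit {K : Type*} [Field K] [Height.AdmissibleAbsValues K]
    [Northcott (Projectivization.logHeight (K := K) (ι := Fin 2))] {n : ℕ}
    {f : Fin n → RatFunc K} (x₀ : ℙ K (Fin 2 → K)) (hdeg : ∀ i, 2 ≤ degree (f i)) :
    ∃ k : ℕ, 0 < k ∧
      (fun B => (heightCount Projectivization.logHeight (orbit f x₀) B : ℝ)) =O[atTop]
        fun B => B ^ k := by
  obtain ⟨C, hC⟩ := exists_two_mul_logHeight_sub_le_logHeight_toMap hdeg
  exact exists_isBigO_pow_heightCount one_lt_two hC (orbit_subset f x₀)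
    ((Set.finite_singleton x₀).image _).bddAbove

instance northcott_logHeight {K : Type*} [Field K] [Height.AdmissibleAbsValues K]
    [Northcott (Height.logHeight₁ (K := K))] :
    Northcott (Projectivization.logHeight (K := K) (ι := Fin 2)) where
  finite_le B := by
    classical
    refine ((((Northcott.finite_le (h := Height.logHeight₁ (K := K)) B).image
      OnePoint.some).insert OnePoint.infty).image (OnePoint.equivProjectivization K)).subset
      fun x hx => ?_
    obtain ⟨z, rfl⟩ := (OnePoint.equivProjectivization K).surjective x
    refine Set.mem_image_of_mem _ ?_
    induction z using OnePoint.rec with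
    | infty => exact .inl rfl
    | coe a =>
      refine .inr (Set.mem_image_of_mem _ ?_)
      rwa [Set.mem_ofPred_eq, OnePoint.equivProjectivization_apply_coe,
        Projectivization.logHeight_mk, ← Height.logHeight₁_eq_logHeight] at hx

section NumberField

variable {K : Type*} [Field K] [NumberField K]

theorem absHeight_pos (x : ℙ K (Fin 2 → K)) : 0 < absHeight x :=
  Real.rpow_pos_of_pos x.mulHeight_pos _

theorem logHeight_eq_finrank_mul_log_absHeight (x : ℙ K (Fin 2 → K)) :
    x.logHeight = Module.finrank ℚ K * Real.log (absHeight x) := by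
  have hd : (Module.finrank ℚ K : ℝ) ≠ 0 := by exact_mod_cast Module.finrank_pos.ne'
  rw [absHeight, Real.log_rpow x.mulHeight_pos, mul_inv_cancel_left₀ hd,
    x.logHeight_eq_log_mulHeight]

theorem heightBall_subset_setOf_logHeight_le (A : Set (ℙ K (Fin 2 → K))) (N : ℝ) :
    heightBall A N ⊆ {x ∈ A | x.logHeight ≤ Module.finrank ℚ K * Real.log N} := by
  rintro x ⟨hxA, hx⟩
  refine ⟨hxA, ?_⟩
  rw [logHeight_eq_finrank_mul_log_absHeight]
  exact mul_le_mul_of_nonneg_left (Real.log_le_log (absHeight_pos x) hx) (Nat.cast_nonneg _)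

theorem finite_heightBall (A : Set (ℙ K (Fin 2 → K))) (N : ℝ) : (heightBall A N).Finite :=
  (finite_setOf_mem_and_le _ _ _).subset (heightBall_subset_setOf_logHeight_le A N)

theorem ncard_heightBall_le_heightCount (A : Set (ℙ K (Fin 2 → K))) (N : ℝ) :
    (heightBall A N).ncard ≤
      heightCount Projectivization.logHeight A (Module.finrank ℚ K * Real.log N) :=
  Set.ncard_le_ncard (heightBall_subset_setOf_logHeight_le A N) (finite_setOf_mem_and_le _ _ _)

theorem exists_ncard_heightBall_orbit_isBigO {n : ℕ} {f : Fin n → RatFunc K}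
    (x₀ : ℙ K (Fin 2 → K)) (hdeg : ∀ i, 2 ≤ degree (f i)) :
    ∃ k : ℕ, 0 < k ∧
      (fun N : ℝ => ((heightBall (orbit f x₀) N).ncard : ℝ)) =O[atTop]
        fun N : ℝ => Real.log N ^ k := by
  obtain ⟨k, hk, hO⟩ := exists_isBigO_pow_heightCount_orbit x₀ hdeg
  have hlog : Tendsto (fun N => Module.finrank ℚ K * Real.log N) atTop atTop :=
    Real.tendsto_log_atTop.const_mul_atTop (by exact_mod_cast Module.finrank_pos)
  refine ⟨k, hk, IsBigO.trans (.of_norm_le fun N => ?_) ((hO.comp_tendsto hlog).trans ?_)⟩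
  · simpa using ncard_heightBall_le_heightCount (orbit f x₀) N
  · simpa only [Function.comp_def, mul_pow] using isBigO_const_mul_self _ _ _

theorem mulHeight₁_natCast (a : ℕ) :
    Height.mulHeight₁ (a : K) = max (a : ℝ) 1 ^ Module.finrank ℚ K := by
  have hfin : ∏ᶠ v : NumberField.FinitePlace K, max (v (a : K)) 1 = 1 :=
    finprod_eq_one_of_forall_eq_one fun v => max_eq_right (by
      rw [← v.norm_embedding_eq]
      simpa using NumberField.FinitePlace.norm_le_one K v.maximalIdeal
        (a : NumberField.RingOfIntegers K))
  rw [NumberField.mulHeight₁_eq, hfin, mul_one, ← NumberField.InfinitePlace.sum_mult_eq,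
    ← Finset.prod_pow_eq_pow_sum]
  simp

theorem absHeight_natCast (a : ℕ) :
    absHeight (Projectivization.mk K ![(a : K), 1] (by simp)) = max (a : ℝ) 1 := by
  rw [absHeight, Projectivization.mulHeight_mk, ← Height.mulHeight₁_eq_mulHeight,
    mulHeight₁_natCast, Real.pow_rpow_inv_natCast (by positivity) Module.finrank_pos.ne']

theorem le_ncard_heightBall_univ {N : ℝ} (hN : 1 ≤ N) :
    N ≤ (heightBall (Set.univ : Set (ℙ K (Fin 2 → K))) N).ncard := by
  classical
  let φ (a : ℕ) : ℙ K (Fin 2 → K) := OnePoint.equivProjectivization K (a : K)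
  have hφ : Function.Injective φ := (OnePoint.equivProjectivization K).injective.comp
    (OnePoint.coe_injective.comp Nat.cast_injective)
  have hsub : φ '' (Finset.range (⌊N⌋₊ + 1) : Set ℕ) ⊆ heightBall Set.univ N := by
    rintro _ ⟨a, ha, rfl⟩
    have haN : (a : ℝ) ≤ N := (Nat.le_floor_iff (by positivity)).1
      (Nat.lt_succ_iff.1 (Finset.mem_range.1 ha))
    refine ⟨Set.mem_univ _, ?_⟩
    simp only [φ, OnePoint.equivProjectivization_apply_coe, absHeight_natCast]
    exact max_le haN hN
  have hcard := Set.ncard_le_ncard hsub (finite_heightBall _ N)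
  rw [Set.ncard_image_of_injective _ hφ, Set.ncard_coe_finset, Finset.card_range] at hcard
  exact (Nat.lt_floor_add_one N).le.trans (by exact_mod_cast hcard)

theorem hasHeightDensity_zero_of_isLittleO {A : Set (ℙ K (Fin 2 → K))}
    (hA : (fun N : ℝ => ((heightBall A N).ncard : ℝ)) =o[atTop] (id : ℝ → ℝ)) :
    HasHeightDensity A 0 := by
  have huniv : (id : ℝ → ℝ) =O[atTop]
      fun N : ℝ => ((heightBall (Set.univ : Set (ℙ K (Fin 2 → K))) N).ncard : ℝ) :=
    IsBigO.of_norm_eventuallyLE <| by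
      filter_upwards [eventually_ge_atTop (1 : ℝ)] with N hN
      rw [id, Real.norm_of_nonneg (by positivity)]
      exact le_ncard_heightBall_univ hN
  have hlim : Tendsto (heightProportion A) atTop (𝓝 0) :=
    (hA.trans_isBigO huniv).tendsto_div_nhds_zero
  exact ⟨hlim.liminf_eq, hlim.limsup_eq⟩

end NumberField

end RationalOrbit

theorem mainTheorem1_general {K : Type*} [Field K] [NumberField K] {n : ℕ}
    (f : Fin n → RatFunc K) (x₀ : ℙ K (Fin 2 → K))
    (hdeg : ∀ i, 2 ≤ RationalOrbit.degree (f i)) :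
    (∀ N : ℝ, (RationalOrbit.heightBall (Set.univ : Set (ℙ K (Fin 2 → K))) N).Finite) ∧
    RationalOrbit.HasHeightDensity (RationalOrbit.orbit f x₀) 0 ∧
    ∃ k : ℕ, 0 < k ∧
      (fun N : ℝ => ((RationalOrbit.heightBall (RationalOrbit.orbit f x₀) N).ncard : ℝ))
        =O[atTop] fun N : ℝ => Real.log N ^ k := by
  obtain ⟨k, hk, hO⟩ := RationalOrbit.exists_ncard_heightBall_orbit_isBigO x₀ hdeg
  exact ⟨fun N => RationalOrbit.finite_heightBall _ N,
    RationalOrbit.hasHeightDensity_zero_of_isLittleO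
      (hO.trans_isLittleO Real.isLittleO_pow_log_id_atTop), k, hk, hO⟩

theorem mainTheorem1 {K : Type*} [Field K] [NumberField K] {n : ℕ}
    (f : Fin n → RatFunc K) (x₀ : ℙ K (Fin 2 → K))
    (hdeg : ∀ i, 2 ≤ RationalOrbit.degree (f i))
    (hinj : RationalOrbit.IsInjectiveAt f x₀) :
    (∀ N : ℝ, (RationalOrbit.heightBall (Set.univ : Set (ℙ K (Fin 2 → K))) N).Finite) ∧
    RationalOrbit.HasHeightDensity (RationalOrbit.orbit f x₀) 0 ∧
    ∃ k : ℕ, 0 < k ∧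
      (fun N : ℝ => ((RationalOrbit.heightBall (RationalOrbit.orbit f x₀) N).ncard : ℝ))
        =O[atTop] fun N : ℝ => Real.log N ^ k :=
  mainTheorem1_general f x₀ hdeg
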